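/- **Model.** Let $G$ be a finite undirected tree in which every node has degree $1$ (a leaf) or degree at least $3$; let $L$ be its number of leaves and $|E|$ its number of edges. Each edge gives two directed links, one per direction. In an experiment every directed link $d$ works with its own probability $\alpha_d\in(0,1]$, independently of all other directed links (the two directions of an edge may have different probabilities). A *configuration* $(G,S,R)$ consists of a partition of the leaves into sources $S$ and receivers $R$ together with an orientation of every edge (the direction in which probes flow), such that edges leave the sources and enter the receivers and every intermediate node has in-degree and out-degree at least one. Its *dual* reverses all orientations and exchanges $S$ and $R$. In one experiment with network coding, the sources inject distinct unit vectors of $\mathbb F_2^{S}$; each intermediate node forwards on all its outgoing links the XOR of the packets that reach it over its working incoming links; the receivers observe the packets that reach them. The *bandwidth* of an experiment is the number of directed links into which a probe is sent when nothing is lost. A *multicast tree* is a configuration with exactly one source (all other leaves are receivers), so that no coding takes place. A *measurement plan* is a finite sequence of configurations, called rounds; it *measures all links in both directions* if, for every directed link $e$ and all $\alpha,\alpha'$ with entries in $(0,1]$, equality of the outcome distributions under $\alpha$ and $\alpha'$ in every round implies $\alpha_e=\alpha'_e$. The bandwidth of a plan is the sum of the bandwidths of its rounds (one experiment per round). **Corollary.**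 1. For every partition of the leaves into a nonempty set $S$ and a nonempty set $R$ there is a configuration with sources $S$ and receivers $R$. 2. For every configuration $c$, the two-round plan formed by $c$ and its dual measures all links in both directions. Each of its two rounds has bandwidth $|E|$, so the plan has bandwidth $2|E|$ (one probe per directed link). 3. No plan that consists of a single configuration measures all links in both directions. 4. A plan of multicast trees that measures all links in both directions contains, for every leaf $A$, a multicast tree rooted at $A$. Hence it has at least $L$ rounds; its bandwidth is at least $L$ times the bandwidth of a network coding round, and at least $L/2$ times the bandwidth of the two-round network coding plan. 5. There is a plan of $L$ multicast trees that measures all links in both directions. It has bandwidth $L\,|E|$, so both bounds in 4 are attained: network coding saves exactly a factor of $L$ in bandwidth per network coding round, that is, a factor of $L/2$ when both rounds (the configuration and its dual) are added up. -/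

import Mathlib

namespace LossTomography

variable {V : Type*} [Fintype V] [DecidableEq V]

/-- The leaves of the tree: the nodes of degree one. -/
def leaves (G : SimpleGraph V) [DecidableRel G.Adj] : Finset V :=
  Finset.univ.filter fun v => G.degree v = 1

/-- A configuration `(G, S, R)` on the undirected topology `G`. A dart of `G` is a directed link,
that is, an edge together with one of its two directions. A configuration uses every edge of `G` in
exactly one direction; every leaf is either a source or a receiver; probes leave the sources
and enter the receivers; an intermediate node has in-degree and out-degree at least one. -/
structure Configuration (G : SimpleGraph V) [DecidableRel G.Adj] where
  /-- the directed links along which probes flow -/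
  links : Finset G.Dart
  sources : Finset V
  receivers : Finset V
  mem_links_iff : ∀ d : G.Dart, d ∈ links ↔ d.symm ∉ links
  disjoint : Disjoint sources receivers
  union_eq : sources ∪ receivers = leaves G
  source_no_in : ∀ d ∈ links, d.snd ∉ sources
  receiver_no_out : ∀ d ∈ links, d.fst ∉ receivers
  exists_in : ∀ v, v ∉ leaves G → ∃ d ∈ links, d.snd = v
  exists_out : ∀ v, v ∉ leaves G → ∃ d ∈ links, d.fst = v

namespace Configuration

variable {G : SimpleGraph V} [DecidableRel G.Adj]

/-- The dual configuration: all links are reversed, sources and receivers exchange their roles. -/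
def dual (c : Configuration G) : Configuration G where
  links := Finset.univ.filter fun d => d.symm ∈ c.links
  sources := c.receivers
  receivers := c.sources
  mem_links_iff d := by
    have h := c.mem_links_iff d.symm
    simpa using h
  disjoint := c.disjoint.symm
  union_eq := by rw [Finset.union_comm]; exact c.union_eq
  source_no_in d hd := c.receiver_no_out d.symm (by simpa using hd)
  receiver_no_out d hd := c.source_no_in d.symm (by simpa using hd)
  exists_in v hv := by
    obtain ⟨d, hd, rfl⟩ := c.exists_out v hv
    exact ⟨d.symm, by simpa using hd, rfl⟩
  exists_out v hv := by
    obtain ⟨d, hd, rfl⟩ := c.exists_in v hv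
    exact ⟨d.symm, by simpa using hd, rfl⟩

/-- A probe packet: a binary vector with one coordinate per source. -/
abbrev Packet (c : Configuration G) : Type _ := {s : V // s ∈ c.sources} → ZMod 2

/-- The packet injected at `v`: the unit vector of `v` if `v` is a source, and nothing otherwise. -/
def injected (c : Configuration G) (v : V) : c.Packet :=
  if h : v ∈ c.sources then Pi.single ⟨v, h⟩ 1 else 0

/-- The node operation. `ω d = true` means that the directed link `d` works in the experiment at
hand. A node holds the packet injected at it, XORed with all the packets that reach it over its
working incoming links; it sends the packet it holds over all its outgoing links. -/
def nodeOperation (c : Configuration G) (ω : G.Dart → Bool) (X : V → c.Packet) : V → c.Packet :=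
  fun v => c.injected v + ∑ d ∈ c.links.filter fun d => d.snd = v ∧ ω d = true, X d.fst

/-- The packets held by the nodes at the end of an experiment with link states `ω`. A directed path
has fewer than `|V|` links, so the node operations have settled after `|V|` steps
(see `packet_eq`). -/
def packet (c : Configuration G) (ω : G.Dart → Bool) : V → c.Packet :=
  (c.nodeOperation ω)^[Fintype.card V] 0

/-- The directed links of a configuration on a tree contain no directed cycle. -/
theorem acyclic (hG : G.IsTree) (c : Configuration G) (v : V) :
    ¬ Relation.TransGen (fun a b => ∃ d ∈ c.links, d.fst = a ∧ d.snd = b) v v := by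
  intro h
  obtain ⟨w, ⟨d, hd, rfl, rfl⟩, hw⟩ := Relation.TransGen.head'_iff.1 h
  have hb : ¬ (G.deleteEdges {s(d.fst, d.snd)}).Reachable d.fst d.snd :=
    SimpleGraph.isBridge_iff.1 (SimpleGraph.isAcyclic_iff_forall_adj_isBridge.1 hG.isAcyclic d.adj)
  refine hb (SimpleGraph.Reachable.symm ?_)
  refine Relation.ReflTransGen.rec
    (motive := fun z _ => (G.deleteEdges {s(d.fst, d.snd)}).Reachable d.snd z) ?_ ?_ hw
  · exact SimpleGraph.Reachable.refl _
  · rintro a b - ⟨f, hf, rfl, rfl⟩ ih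
    by_cases he : s(f.fst, f.snd) = s(d.fst, d.snd)
    · rcases Sym2.eq_iff.1 he with ⟨-, h2⟩ | ⟨h1, h2⟩
      · rw [h2]
      · have hfd : f = d.symm := by
          ext
          · exact h1
          · exact h2
        exact absurd (hfd ▸ hf) ((c.mem_links_iff d).1 hd)
    · refine ih.trans (SimpleGraph.Adj.reachable ?_)
      rw [SimpleGraph.deleteEdges_adj]
      exact ⟨f.adj, by simpa using he⟩

/-- On a tree, the packets of an experiment satisfy the node equations: every node holds the packet
injected at it, XORed with the packets of the nodes from which it has a working incoming link. -/
theorem packet_eq (hG : G.IsTree) (c : Configuration G) (ω : G.Dart → Bool) (v : V) :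
    c.packet ω v =
      c.injected v + ∑ d ∈ c.links.filter fun d => d.snd = v ∧ ω d = true, c.packet ω d.fst := by
  classical
  let anc : V → Finset V := fun v => Finset.univ.filter fun u =>
    Relation.TransGen (fun a b => ∃ d ∈ c.links, d.fst = a ∧ d.snd = b) u v
  have hlt : ∀ d ∈ c.links, (anc d.fst).card < (anc d.snd).card := fun d hd => by
    refine Finset.card_lt_card ⟨fun u hu => ?_, fun h => ?_⟩
    · simp only [anc, Finset.mem_filter, Finset.mem_univ, true_and] at hu ⊢
      exact hu.tail ⟨d, hd, rfl, rfl⟩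
    · have : d.fst ∈ anc d.fst := h (by
        simp only [anc, Finset.mem_filter, Finset.mem_univ, true_and]
        exact Relation.TransGen.single ⟨d, hd, rfl, rfl⟩)
      simp only [anc, Finset.mem_filter, Finset.mem_univ, true_and] at this
      exact c.acyclic hG _ this
  have key : ∀ n v, (anc v).card < n →
      (c.nodeOperation ω)^[n] 0 v = (c.nodeOperation ω)^[n + 1] 0 v := by
    intro n
    induction n with
    | zero => intro v h; exact absurd h (Nat.not_lt_zero _)
    | succ n ih =>
      intro v h
      rw [Function.iterate_succ_apply', Function.iterate_succ_apply' _ (n + 1)]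
      unfold nodeOperation
      congr 1
      refine Finset.sum_congr rfl fun d hd => ?_
      rw [Finset.mem_filter] at hd
      have := hlt d hd.1
      rw [hd.2.1] at this
      exact ih d.fst (by omega)
  have hcard : (anc v).card < Fintype.card V := by
    refine Finset.card_lt_univ_of_notMem (x := v) fun h => ?_
    simp only [anc, Finset.mem_filter, Finset.mem_univ, true_and] at h
    exact c.acyclic hG _ h
  have h := key _ v hcard
  rw [Function.iterate_succ_apply'] at h
  exact h

/-- The outcome of one experiment: the packets collected by the receivers. -/
abbrev Outcome (c : Configuration G) : Type _ := {r : V // r ∈ c.receivers} → c.Packet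

/-- The outcome when the link states are `ω`. -/
def outcome (c : Configuration G) (ω : G.Dart → Bool) : c.Outcome := fun r => c.packet ω r

/-- The probability mass function `p(x; α)` of the outcome of one experiment, when the directed
links work independently of each other, link `d` with probability `α d`. The two directions of an
edge have separate success probabilities. -/
def pmf (c : Configuration G) (α : G.Dart → ℝ) (x : c.Outcome) : ℝ :=
  ∑ ω : G.Dart → Bool,
    if c.outcome ω = x then ∏ d, (if ω d = true then α d else 1 - α d) else 0

/-- The probe bandwidth of one experiment: the number of directed links into which a probe packet
is sent when no packet is lost. -/
def bandwidth (c : Configuration G) : ℕ :=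
  (c.links.filter fun d => c.packet (fun _ => true) d.fst ≠ 0).card

/-- A multicast tree: a configuration with a single source; all the other leaves are receivers. -/
def IsMulticastTree (c : Configuration G) : Prop := c.sources.card = 1

end Configuration

variable {G : SimpleGraph V} [DecidableRel G.Adj]

/-- A measurement plan is a finite sequence of rounds; round `i` consists of independent
experiments with configuration `T i`. The plan identifies the directed link `e` if the outcome
distributions of its rounds determine the success probability of `e`, among all the vectors of
success probabilities in `(0, 1]`. -/
def Identifies {k : ℕ} (T : Fin k → Configuration G) (e : G.Dart) : Prop :=
  ∀ α α' : G.Dart → ℝ, (∀ d, 0 < α d ∧ α d ≤ 1) → (∀ d, 0 < α' d ∧ α' d ≤ 1) →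
    (∀ i, (T i).pmf α = (T i).pmf α') → α e = α' e

/-- The plan measures all the links of the tree in both directions. -/
def MeasuresBothDirections {k : ℕ} (T : Fin k → Configuration G) : Prop :=
  ∀ e : G.Dart, Identifies T e

/-- The total bandwidth of a plan, for one experiment in each round. -/
def planBandwidth {k : ℕ} (T : Fin k → Configuration G) : ℕ := ∑ i, (T i).bandwidth

end LossTomography

namespace LossTomography

open SimpleGraph

/-! In a tree at most one directed walk joins two nodes, so copies of a source's packet never meet
and cancel. Hence coordinate `s` of the packet at a node is the indicator that all links of the
directed path from `s` work (`packet_apply`). With no losses every link therefore carries a probe,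
and a round has bandwidth equal to the number of edges.

A configuration determines exactly the links it uses. The outcome distribution yields the
probability that two source-to-receiver paths work together (`prod_union_eq`). An intermediate node
has a third neighbour, so two such paths can share one arm at the node and differ in the other; the
probabilities of the paths and of their union fix each arm (`prod_darts_eq_of_notMem_leaves`), and
division isolates a single link (`eq_of_mem_links`). Conversely, an unused link does not influence
the outcome (`pmf_update`).

Measuring both directions thus means covering every dart by some round. A configuration and its dual
do so, and one round cannot. The dart leaving a leaf `A` is used by a multicast tree only if its
root is `A`. Conversely, the trees rooted at all leaves cover every dart, since each dart points
away from some leaf. -/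

theorem eq_of_isPath {V : Type*} {G : SimpleGraph V} (hG : G.IsTree) {u v : V} {w w' : G.Walk u v}
    (hw : w.IsPath) (hw' : w'.IsPath) : w = w' :=
  congrArg Subtype.val ((hG.isAcyclic.subsingleton_path u v).elim ⟨w, hw⟩ ⟨w', hw'⟩)

theorem exists_walk_concat {V : Type*} {G : SimpleGraph V} {u v : V} (w : G.Walk u v) (h : v ≠ u) :
    ∃ (x : V) (q : G.Walk u x) (hx : G.Adj x v), w = q.concat hx := by
  cases w with
  | nil => exact absurd rfl h
  | cons h p => exact Walk.exists_cons_eq_concat h p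

/-! ### Directed walks in a configuration. -/

namespace Configuration

variable {V : Type*} [Fintype V] [DecidableEq V] {G : SimpleGraph V} [DecidableRel G.Adj]

/-- A walk that follows the flow of the probes. -/
def IsDirected (c : Configuration G) {u v : V} (w : G.Walk u v) : Prop := ∀ d ∈ w.darts, d ∈ c.links

variable {c : Configuration G}

theorem isDirected_nil (u : V) : c.IsDirected (Walk.nil : G.Walk u u) := by
  simp [IsDirected]

theorem isDirected_cons {u v w : V} {h : G.Adj u v} {p : G.Walk v w} :
    c.IsDirected (Walk.cons h p) ↔ ⟨(u, v), h⟩ ∈ c.links ∧ c.IsDirected p := by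
  simp [IsDirected]

theorem isDirected_append {u v w : V} {p : G.Walk u v} {q : G.Walk v w} :
    c.IsDirected (p.append q) ↔ c.IsDirected p ∧ c.IsDirected q := by
  simp only [IsDirected, Walk.darts_append, List.mem_append]
  exact ⟨fun h => ⟨fun d hd => h d (.inl hd), fun d hd => h d (.inr hd)⟩,
    fun h d hd => hd.elim (h.1 d) (h.2 d)⟩

theorem isDirected_concat {u v w : V} {p : G.Walk u v} {h : G.Adj v w} :
    c.IsDirected (p.concat h) ↔ c.IsDirected p ∧ ⟨(v, w), h⟩ ∈ c.links := by
  rw [Walk.concat_eq_append, isDirected_append, isDirected_cons]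
  simp [isDirected_nil]

theorem mem_dual_links {d : G.Dart} : d ∈ c.dual.links ↔ d.symm ∈ c.links := by
  simp [dual]

theorem isDirected_reverse {u v : V} {w : G.Walk u v} :
    c.dual.IsDirected w.reverse ↔ c.IsDirected w := by
  simp only [IsDirected, Walk.darts_reverse, List.mem_reverse, List.mem_map, mem_dual_links]
  exact ⟨fun h d hd => by simpa using h d.symm ⟨d, hd, rfl⟩, by
    rintro h _ ⟨d, hd, rfl⟩; simpa using h d hd⟩

theorem mem_links_or (c : Configuration G) (d : G.Dart) : d ∈ c.links ∨ d.symm ∈ c.links := by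
  by_cases h : d.symm ∈ c.links
  · exact .inr h
  · exact .inl ((c.mem_links_iff d).2 h)

theorem IsDirected.reflTransGen {u v : V} {w : G.Walk u v} (hw : c.IsDirected w) :
    Relation.ReflTransGen (fun a b => ∃ d ∈ c.links, d.fst = a ∧ d.snd = b) u v := by
  induction w with
  | nil => exact .refl
  | cons h p ih =>
    rw [isDirected_cons] at hw
    exact .head ⟨_, hw.1, rfl, rfl⟩ (ih hw.2)

/-- A repeated node would close a directed cycle, against `acyclic`. -/
theorem IsDirected.isPath (hG : G.IsTree) {u v : V} {w : G.Walk u v} (hw : c.IsDirected w) :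
    w.IsPath := by
  induction w with
  | nil => exact .nil
  | @cons u v w h p ih =>
    rw [isDirected_cons] at hw
    refine (Walk.cons_isPath_iff h p).2 ⟨ih hw.2, fun hu => c.acyclic hG u ?_⟩
    have hq : c.IsDirected (p.takeUntil u hu) :=
      fun d hd => hw.2 d (p.darts_takeUntil_subset_darts hu hd)
    exact .head' ⟨_, hw.1, rfl, rfl⟩ hq.reflTransGen

theorem IsDirected.eq (hG : G.IsTree) {u v : V} {w w' : G.Walk u v} (hw : c.IsDirected w)
    (hw' : c.IsDirected w') : w = w' :=
  eq_of_isPath hG (hw.isPath hG) (hw'.isPath hG)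

/-- Acyclicity on a finite node set; this permits induction along the flow, from the sources
onwards. -/
theorem wellFounded_flow (hG : G.IsTree) (c : Configuration G) :
    WellFounded (fun a b => ∃ d ∈ c.links, d.fst = a ∧ d.snd = b) := by
  have : IsTrans V (Relation.TransGen fun a b => ∃ d ∈ c.links, d.fst = a ∧ d.snd = b) :=
    ⟨fun _ _ _ => Relation.TransGen.trans⟩
  have : Std.Irrefl (Relation.TransGen fun a b => ∃ d ∈ c.links, d.fst = a ∧ d.snd = b) :=
    ⟨c.acyclic hG⟩
  exact Subrelation.wf (fun h => Relation.TransGen.single h)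
    (Finite.wellFounded_of_trans_of_irrefl
      (Relation.TransGen fun a b => ∃ d ∈ c.links, d.fst = a ∧ d.snd = b))

theorem mem_sources_or_exists_in (c : Configuration G) (hdeg : ∀ v, 0 < G.degree v) (v : V) :
    v ∈ c.sources ∨ ∃ d ∈ c.links, d.snd = v := by
  by_cases hv : v ∈ leaves G
  · rw [← c.union_eq, Finset.mem_union] at hv
    refine hv.imp_right fun hr => ?_
    obtain ⟨w, hw⟩ := (G.degree_pos_iff_exists_adj v).1 (hdeg v)
    refine ⟨⟨(w, v), hw.symm⟩, (c.mem_links_or _).resolve_right fun h => ?_, rfl⟩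
    exact c.receiver_no_out _ h hr
  · exact .inr (c.exists_in v hv)

/-- Every node is reached by the probes of some source. -/
theorem exists_isDirected_from_source (hG : G.IsTree) (c : Configuration G)
    (hdeg : ∀ v, 0 < G.degree v) (v : V) :
    ∃ s ∈ c.sources, ∃ w : G.Walk s v, c.IsDirected w := by
  induction v using (c.wellFounded_flow hG).induction with
  | h v ih =>
    rcases c.mem_sources_or_exists_in hdeg v with hv | ⟨d, hd, rfl⟩
    · exact ⟨v, hv, .nil, isDirected_nil v⟩
    · obtain ⟨s, hs, w, hw⟩ := ih d.fst ⟨d, hd, rfl, rfl⟩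
      exact ⟨s, hs, w.concat d.adj, isDirected_concat.2 ⟨hw, hd⟩⟩

/-- The probes leaving a node reach some receiver. -/
theorem exists_isDirected_to_receiver (hG : G.IsTree) (c : Configuration G)
    (hdeg : ∀ v, 0 < G.degree v) (v : V) :
    ∃ r ∈ c.receivers, ∃ w : G.Walk v r, c.IsDirected w := by
  obtain ⟨r, hr, w, hw⟩ := exists_isDirected_from_source hG c.dual hdeg v
  refine ⟨r, hr, w.reverse, ?_⟩
  rw [← isDirected_reverse, Walk.reverse_reverse]
  exact hw

/-! ### Packets as path indicators, and the bandwidth of a round. -/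

open Classical in
/-- The packet held by `v` has a nonzero coordinate at the source `s` exactly if all the links of
the directed path from `s` to `v` work. -/
theorem packet_apply (hG : G.IsTree) (c : Configuration G) (ω : G.Dart → Bool)
    (s : {s : V // s ∈ c.sources}) (v : V) :
    c.packet ω v s =
      if ∃ w : G.Walk s v, c.IsDirected w ∧ ∀ d ∈ w.darts, ω d = true then 1 else 0 := by
  classical
  induction v using (c.wellFounded_flow hG).induction with
  | h v ih =>
    rw [c.packet_eq hG, Pi.add_apply, Finset.sum_apply]
    by_cases hv : v = s
    · subst hv
      rw [Finset.sum_eq_zero, if_pos ⟨.nil, isDirected_nil _, by simp⟩]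
      · simp [injected, s.2]
      · intro d hd
        rw [Finset.mem_filter] at hd
        exact absurd (hd.2.1 ▸ s.2) (c.source_no_in d hd.1)
    · have h0 : c.injected v s = 0 := by
        unfold injected
        split
        · exact Pi.single_eq_of_ne (fun h => hv (by rw [h])) _
        · rfl
      rw [h0, zero_add]
      split_ifs with h
      · obtain ⟨w, hw, hω⟩ := h
        obtain ⟨x, q, hx, rfl⟩ := exists_walk_concat w hv
        have hw' := isDirected_concat.1 hw
        have hωq : (∀ d ∈ q.darts, ω d = true) ∧ ω ⟨(x, v), hx⟩ = true := by
          simpa [Walk.darts_concat, or_imp, forall_and] using hω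
        rw [Finset.sum_eq_single ⟨(x, v), hx⟩]
        · rw [ih x ⟨_, hw'.2, rfl, rfl⟩, if_pos ⟨q, hw'.1, hωq.1⟩]
        · intro d hd hne
          obtain ⟨hdl, rfl, -⟩ := Finset.mem_filter.1 hd
          rw [ih d.fst ⟨d, hdl, rfl, rfl⟩, if_neg]
          rintro ⟨w', hdir, -⟩
          -- A contribution over another incoming link would give a second directed walk from `s` to
          -- the same node, with a different last link.
          have := (isDirected_concat.2 ⟨hdir, hdl⟩ : c.IsDirected (w'.concat d.adj)).eq hG hw
          have := congrArg (fun w => w.darts.getLast?) this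
          simp only [Walk.darts_concat, List.concat_eq_append, List.getLast?_concat,
            Option.some.injEq] at this
          exact hne this
        · intro hn
          exact absurd (Finset.mem_filter.2 ⟨hw'.2, rfl, hωq.2⟩) hn
      · refine Finset.sum_eq_zero fun d hd => ?_
        obtain ⟨hdl, rfl, hωd⟩ := Finset.mem_filter.1 hd
        rw [ih d.fst ⟨d, hdl, rfl, rfl⟩, if_neg]
        rintro ⟨w, hw, hω⟩
        refine h ⟨w.concat d.adj, isDirected_concat.2 ⟨hw, hdl⟩, ?_⟩
        simpa [Walk.darts_concat, or_imp, forall_and] using ⟨hω, hωd⟩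

theorem packet_apply_eq_one_iff (hG : G.IsTree) (ω : G.Dart → Bool) (s : {s : V // s ∈ c.sources})
    {v : V} {w : G.Walk s v} (hw : c.IsDirected w) :
    c.packet ω v s = 1 ↔ ∀ d ∈ w.darts, ω d = true := by
  classical
  rw [c.packet_apply hG]
  constructor
  · intro h
    split_ifs at h with hx
    · obtain ⟨w', hw', hω⟩ := hx
      rwa [hw.eq hG hw']
    · simp at h
  · exact fun h => if_pos ⟨w, hw, h⟩

/-- Reversal is a bijection between the used and the unused darts, so half of the darts are used. -/
theorem card_links (c : Configuration G) : c.links.card = G.edgeFinset.card := by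
  have h1 := G.dart_card_eq_twice_card_edges
  have h2 : c.linksᶜ.card = c.links.card := by
    refine Finset.card_nbij' Dart.symm Dart.symm ?_ ?_ ?_ ?_
    · intro d hd
      exact (c.mem_links_or d).resolve_left (by simpa using hd)
    · intro d hd
      simpa using (c.mem_links_iff d).1 hd
    · intro d _; simp
    · intro d _; simp
  have h3 := Finset.card_add_card_compl c.links
  omega

/-- Some source reaches the tail of each link, and without losses its coordinate there is 1: nothing
cancels. -/
theorem bandwidth_eq (hG : G.IsTree) (hdeg : ∀ v, 0 < G.degree v) (c : Configuration G) :
    c.bandwidth = G.edgeFinset.card := by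
  rw [bandwidth, Finset.filter_true_of_mem, card_links]
  intro d _ h
  obtain ⟨s, hs, w, hw⟩ := c.exists_isDirected_from_source hG hdeg d.fst
  have := (packet_apply_eq_one_iff hG (fun _ => true) ⟨s, hs⟩ hw).2 fun _ _ => rfl
  rw [h] at this
  exact zero_ne_one this

/-! ### Probabilities of path events. -/

/-- The probability that all the links in `U` work. -/
theorem sum_weight_of_forall_mem (α : G.Dart → ℝ) (U : Finset G.Dart) :
    ∑ ω : G.Dart → Bool, (if ∀ d ∈ U, ω d = true then
      ∏ d, (if ω d = true then α d else 1 - α d) else 0) = ∏ d ∈ U, α d := by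
  -- Moving the condition into the factors, as a factor 0 for a failing link of `U`, makes the sum
  -- over `ω` a product of sums over single links.
  have h : ∀ ω : G.Dart → Bool, (if ∀ d ∈ U, ω d = true then
      ∏ d, (if ω d = true then α d else 1 - α d) else 0) =
      ∏ d, (if ω d = true then α d else if d ∈ U then 0 else 1 - α d) := by
    intro ω
    split_ifs with h
    · refine Finset.prod_congr rfl fun d _ => ?_
      by_cases hd : d ∈ U
      · simp [h d hd]
      · simp [hd]
    · push Not at h
      obtain ⟨d, hd, hω⟩ := h
      exact (Finset.prod_eq_zero (Finset.mem_univ d) (by simp [hd, hω])).symm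
  rw [Finset.sum_congr rfl fun ω _ => h ω,
    ← Fintype.prod_sum fun d b => if b = true then α d else if d ∈ U then 0 else 1 - α d]
  rw [← Finset.prod_subset (Finset.subset_univ U)]
  · exact Finset.prod_congr rfl fun d hd => by simp [hd]
  · intro d _ hd
    simp [hd]

/-- If an event of the outcome says that all the links in `U` work, then its probability is the
product of their success probabilities. -/
theorem sum_pmf_of_iff (c : Configuration G) (α : G.Dart → ℝ) (U : Finset G.Dart)
    (Q : c.Outcome → Prop) [DecidablePred Q] (hQ : ∀ ω, Q (c.outcome ω) ↔ ∀ d ∈ U, ω d = true) :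
    ∑ x, (if Q x then c.pmf α x else 0) = ∏ d ∈ U, α d := by
  rw [← sum_weight_of_forall_mem]
  simp only [pmf]
  simp_rw [← Finset.sum_filter (p := Q)]
  rw [Finset.sum_comm]
  refine Finset.sum_congr rfl fun ω _ => ?_
  rw [Finset.sum_ite_eq]
  simp [hQ]

/-- The outcome distribution determines the probability that two directed walks from sources to
receivers work at the same time. -/
theorem prod_union_eq (hG : G.IsTree) {α α' : G.Dart → ℝ} (hα : c.pmf α = c.pmf α')
    {s r s' r' : V} {w : G.Walk s r} {w' : G.Walk s' r'} (hw : c.IsDirected w)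
    (hw' : c.IsDirected w') (hs : s ∈ c.sources) (hr : r ∈ c.receivers)
    (hs' : s' ∈ c.sources) (hr' : r' ∈ c.receivers) :
    ∏ d ∈ w.darts.toFinset ∪ w'.darts.toFinset, α d =
      ∏ d ∈ w.darts.toFinset ∪ w'.darts.toFinset, α' d := by
  classical
  have hQ : ∀ ω, (c.outcome ω ⟨r, hr⟩ ⟨s, hs⟩ = 1 ∧ c.outcome ω ⟨r', hr'⟩ ⟨s', hs'⟩ = 1) ↔
      ∀ d ∈ w.darts.toFinset ∪ w'.darts.toFinset, ω d = true := by
    intro ω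
    have h1 := packet_apply_eq_one_iff hG ω ⟨s, hs⟩ hw
    have h2 := packet_apply_eq_one_iff hG ω ⟨s', hs'⟩ hw'
    simp only [outcome, h1, h2, Finset.mem_union, List.mem_toFinset, or_imp, forall_and]
  rw [← c.sum_pmf_of_iff α _ (fun x => x ⟨r, hr⟩ ⟨s, hs⟩ = 1 ∧ x ⟨r', hr'⟩ ⟨s', hs'⟩ = 1) hQ,
    ← c.sum_pmf_of_iff α' _ (fun x => x ⟨r, hr⟩ ⟨s, hs⟩ = 1 ∧ x ⟨r', hr'⟩ ⟨s', hs'⟩ = 1) hQ, hα]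

/-! ### Identifiability of the used links. -/

theorem IsDirected.disjoint_append (hG : G.IsTree) {u v w : V} {p : G.Walk u v} {q : G.Walk v w}
    (hp : c.IsDirected p) (hq : c.IsDirected q) :
    Disjoint p.darts.toFinset q.darts.toFinset := by
  have h := Walk.darts_nodup_of_support_nodup
    ((isDirected_append.2 ⟨hp, hq⟩).isPath hG).support_nodup
  rw [Walk.darts_append, List.nodup_append'] at h
  rw [List.disjoint_toFinset_iff_disjoint]
  exact h.2.2

/-- Directed walks that start with different links have no link in common. -/
theorem IsDirected.disjoint_cons (hG : G.IsTree) {u x y w w' : V} {h : G.Adj u x} {h' : G.Adj u y}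
    {p : G.Walk x w} {q : G.Walk y w'} (hp : c.IsDirected (Walk.cons h p))
    (hq : c.IsDirected (Walk.cons h' q)) (hxy : x ≠ y) :
    Disjoint (Walk.cons h p).darts.toFinset (Walk.cons h' q).darts.toFinset := by
  have key : ∀ {z : V} (h : G.Adj u z) {t : V} (p : G.Walk z t) (d : G.Dart),
      d ∈ (Walk.cons h p).darts → d.snd ∈ p.support := by
    intro z h t p d hd
    have : d.snd ∈ (Walk.cons h p).darts.map (·.snd) := List.mem_map_of_mem hd
    rwa [Walk.map_snd_darts, Walk.support_cons, List.tail_cons] at this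
  rw [Finset.disjoint_left]
  intro d hd hd'
  rw [List.mem_toFinset] at hd hd'
  have h1 := key h p d hd
  have h2 := key h' q d hd'
  rw [isDirected_cons] at hp hq
  -- Both walks, cut at the head of the common link, are directed walks with the same ends, hence
  -- equal; so their first links agree.
  have e1 : c.IsDirected (Walk.cons h (p.takeUntil _ h1)) := isDirected_cons.2
    ⟨hp.1, fun f hf => hp.2 f (p.darts_takeUntil_subset_darts h1 hf)⟩
  have e2 : c.IsDirected (Walk.cons h' (q.takeUntil _ h2)) := isDirected_cons.2
    ⟨hq.1, fun f hf => hq.2 f (q.darts_takeUntil_subset_darts h2 hf)⟩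
  have := congrArg (fun w => w.darts.head?) (e1.eq hG e2)
  simp only [Walk.darts_cons, List.head?_cons, Option.some.injEq, Dart.mk.injEq, Prod.mk.injEq,
    true_and] at this
  exact hxy this

/-- Directed walks that end with different links have no link in common. -/
theorem IsDirected.disjoint_concat (hG : G.IsTree) {u x y w w' : V} {h : G.Adj x u}
    {h' : G.Adj y u} {p : G.Walk w x} {q : G.Walk w' y} (hp : c.IsDirected (p.concat h))
    (hq : c.IsDirected (q.concat h')) (hxy : x ≠ y) :
    Disjoint (p.concat h).darts.toFinset (q.concat h').darts.toFinset := by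
  have e1 := isDirected_reverse.2 hp
  have e2 := isDirected_reverse.2 hq
  rw [Walk.reverse_concat] at e1 e2
  have := e1.disjoint_cons hG e2 hxy
  rw [← Walk.reverse_concat p h, ← Walk.reverse_concat q h', Finset.disjoint_left] at this
  rw [Finset.disjoint_left]
  have key : ∀ {a b : V} (w : G.Walk a b) (d : G.Dart), d ∈ w.darts.toFinset →
      d.symm ∈ w.reverse.darts.toFinset := by
    intro a b w d hd
    rw [List.mem_toFinset] at hd ⊢
    rw [Walk.darts_reverse, List.mem_reverse]
    exact List.mem_map_of_mem hd
  exact fun d hd hd' => this (key _ d hd) (key _ d hd')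

/-- Three arms at a node: `x` is the arm shared by two paths, `y` and `z` are the arms in which they
differ. The products come from the two paths and from their union. -/
theorem eq_of_mul_eq {x y z x' y' z' : ℝ} (hx : 0 < x) (hz : 0 < z) (hx' : 0 < x')
    (hy' : 0 < y') (h1 : x * y = x' * y') (h2 : x * z = x' * z')
    (h3 : x * y * z = x' * y' * z') : x = x' ∧ y = y' := by
  have e1 : z = z' := by
    rw [h1] at h3
    exact mul_left_cancel₀ (mul_pos hx' hy').ne' h3
  subst e1
  have e2 : x = x' := mul_right_cancel₀ hz.ne' h2
  subst e2
  exact ⟨rfl, mul_left_cancel₀ hx.ne' h1⟩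

theorem prod_darts_append (hG : G.IsTree) (α : G.Dart → ℝ) {u v w : V} {p : G.Walk u v}
    {q : G.Walk v w} (hp : c.IsDirected p) (hq : c.IsDirected q) :
    ∏ d ∈ (p.append q).darts.toFinset, α d =
      (∏ d ∈ p.darts.toFinset, α d) * ∏ d ∈ q.darts.toFinset, α d := by
  rw [Walk.darts_append, List.toFinset_append, Finset.prod_union (hp.disjoint_append hG hq)]

theorem prod_darts_eq (hG : G.IsTree) {α α' : G.Dart → ℝ} (hα : c.pmf α = c.pmf α')
    {s r : V} {w : G.Walk s r} (hw : c.IsDirected w) (hs : s ∈ c.sources)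
    (hr : r ∈ c.receivers) : ∏ d ∈ w.darts.toFinset, α d = ∏ d ∈ w.darts.toFinset, α' d := by
  simpa using prod_union_eq hG hα hw hw hs hr hs hr

/-- At an intermediate node, the outcome distribution determines the probabilities of the parts
before and after the node of every directed walk from a source to a receiver. -/
theorem prod_darts_eq_of_notMem_leaves (hG : G.IsTree)
    (hdeg : ∀ v, G.degree v = 1 ∨ 3 ≤ G.degree v) {α α' : G.Dart → ℝ} (hpos : ∀ d, 0 < α d)
    (hpos' : ∀ d, 0 < α' d) (hα : c.pmf α = c.pmf α') {s v r : V} (hv : v ∉ leaves G)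
    (hs : s ∈ c.sources) (hr : r ∈ c.receivers) {p : G.Walk s v} {q : G.Walk v r}
    (hp : c.IsDirected p) (hq : c.IsDirected q) :
    ∏ d ∈ p.darts.toFinset, α d = ∏ d ∈ p.darts.toFinset, α' d ∧
      ∏ d ∈ q.darts.toFinset, α d = ∏ d ∈ q.darts.toFinset, α' d := by
  have hdeg0 : ∀ v, 0 < G.degree v := fun v => by have := hdeg v; omega
  have hdv : 3 ≤ G.degree v := (hdeg v).resolve_left fun h => hv (by simpa [leaves] using h)
  have hP : ∀ U : Finset G.Dart, 0 < ∏ d ∈ U, α d := fun U => Finset.prod_pos fun d _ => hpos d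
  have hP' : ∀ U : Finset G.Dart, 0 < ∏ d ∈ U, α' d := fun U => Finset.prod_pos fun d _ => hpos' d
  have hpq := prod_darts_eq hG hα (isDirected_append.2 ⟨hp, hq⟩) hs hr
  rw [prod_darts_append hG α hp hq, prod_darts_append hG α' hp hq] at hpq
  have hsv : v ≠ s := by
    rintro rfl
    exact hv (c.union_eq ▸ Finset.mem_union_left _ hs)
  obtain ⟨x, p', hx, rfl⟩ := exists_walk_concat p hsv
  cases q with
  | nil => exact absurd (c.union_eq ▸ Finset.mem_union_right _ hr) hv
  | @cons _ y _ hy q' =>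
  -- Degree at least 3 gives a neighbour off the path through `v`. If its link leaves `v`, it starts
  -- a branch to a receiver and `p` is the shared arm; if it enters `v`, it ends a branch from a
  -- source and `q` is the shared arm.
  obtain ⟨z, hz, hzn⟩ := Finset.exists_mem_notMem_of_card_lt_card
    (s := {x, y}) (t := G.neighborFinset v)
    (lt_of_le_of_lt Finset.card_le_two (by rw [card_neighborFinset_eq_degree]; omega))
  simp only [mem_neighborFinset, Finset.mem_insert, Finset.mem_singleton, not_or] at hz hzn
  rcases c.mem_links_or ⟨(v, z), hz⟩ with hl | hl
  · obtain ⟨r', hr', t', ht'⟩ := c.exists_isDirected_to_receiver hG hdeg0 z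
    have ht : c.IsDirected (Walk.cons hz t') := isDirected_cons.2 ⟨hl, ht'⟩
    have hpt := prod_darts_eq hG hα (isDirected_append.2 ⟨hp, ht⟩) hs hr'
    rw [prod_darts_append hG α hp ht, prod_darts_append hG α' hp ht] at hpt
    have h3 := prod_union_eq hG hα (isDirected_append.2 ⟨hp, hq⟩) (isDirected_append.2 ⟨hp, ht⟩)
      hs hr hs hr'
    have hd := hq.disjoint_cons hG ht (Ne.symm hzn.2)
    have hd' := hp.disjoint_append hG ht
    have e : ∀ β : G.Dart → ℝ, ∏ d ∈ (((p'.concat hx).append (Walk.cons hy q')).darts.toFinset ∪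
        ((p'.concat hx).append (Walk.cons hz t')).darts.toFinset), β d =
        (∏ d ∈ (p'.concat hx).darts.toFinset, β d) * (∏ d ∈ (Walk.cons hy q').darts.toFinset, β d) *
          ∏ d ∈ (Walk.cons hz t').darts.toFinset, β d := by
      intro β
      rw [← prod_darts_append hG β hp hq, ← Finset.prod_union]
      · rw [Walk.darts_append, Walk.darts_append, List.toFinset_append, List.toFinset_append,
          Finset.union_union_union_comm, Finset.union_self, Finset.union_assoc]
      · rw [Walk.darts_append, List.toFinset_append, Finset.disjoint_union_left]
        exact ⟨hd', hd⟩
    rw [e, e] at h3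
    exact eq_of_mul_eq (hP _) (hP _) (hP' _) (hP' _) hpq hpt h3
  · obtain ⟨s', hs', t', ht'⟩ := c.exists_isDirected_from_source hG hdeg0 z
    have ht : c.IsDirected (t'.concat hz.symm) := isDirected_concat.2 ⟨ht', hl⟩
    have hpt := prod_darts_eq hG hα (isDirected_append.2 ⟨ht, hq⟩) hs' hr
    rw [prod_darts_append hG α ht hq, prod_darts_append hG α' ht hq] at hpt
    have h3 := prod_union_eq hG hα (isDirected_append.2 ⟨hp, hq⟩) (isDirected_append.2 ⟨ht, hq⟩)
      hs hr hs' hr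
    have hd := hp.disjoint_concat hG ht (Ne.symm hzn.1)
    have hd' := ht.disjoint_append hG hq
    have e : ∀ β : G.Dart → ℝ, ∏ d ∈ (((p'.concat hx).append (Walk.cons hy q')).darts.toFinset ∪
        ((t'.concat hz.symm).append (Walk.cons hy q')).darts.toFinset), β d =
        (∏ d ∈ (p'.concat hx).darts.toFinset, β d) * (∏ d ∈ (Walk.cons hy q').darts.toFinset, β d) *
          ∏ d ∈ (t'.concat hz.symm).darts.toFinset, β d := by
      intro β
      rw [← prod_darts_append hG β hp hq, ← Finset.prod_union]
      · rw [Walk.darts_append, Walk.darts_append, List.toFinset_append, List.toFinset_append,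
          Finset.union_union_union_comm, Finset.union_self, Finset.union_right_comm]
      · rw [Walk.darts_append, List.toFinset_append, Finset.disjoint_union_left]
        exact ⟨hd, hd'.symm⟩
    rw [e, e] at h3
    exact (eq_of_mul_eq (hP _) (hP (t'.concat hz.symm).darts.toFinset) (hP' _) (hP' _)
      (by linarith) (by linarith) (by linarith)).symm

/-- The outcome distribution of a configuration determines the success probabilities of all its
links. -/
theorem eq_of_mem_links (hG : G.IsTree)
    (hdeg : ∀ v, G.degree v = 1 ∨ 3 ≤ G.degree v) {α α' : G.Dart → ℝ} (hpos : ∀ d, 0 < α d)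
    (hpos' : ∀ d, 0 < α' d) (hα : c.pmf α = c.pmf α') {e : G.Dart} (he : e ∈ c.links) :
    α e = α' e := by
  have hdeg0 : ∀ v, 0 < G.degree v := fun v => by have := hdeg v; omega
  -- The walks before and after `e` have known probability: at a leaf the walk is empty, elsewhere
  -- the previous lemma applies. Dividing them out of a full path leaves `e`.
  have h1 : ∃ s ∈ c.sources, ∃ p : G.Walk s e.fst, c.IsDirected p ∧
      ∏ d ∈ p.darts.toFinset, α d = ∏ d ∈ p.darts.toFinset, α' d := by
    by_cases hv : e.fst ∈ leaves G
    · rw [← c.union_eq, Finset.mem_union] at hv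
      exact ⟨_, hv.resolve_right (c.receiver_no_out e he), .nil, isDirected_nil _, by simp⟩
    · obtain ⟨s, hs, p, hp⟩ := c.exists_isDirected_from_source hG hdeg0 e.fst
      obtain ⟨r, hr, q, hq⟩ := c.exists_isDirected_to_receiver hG hdeg0 e.fst
      exact ⟨s, hs, p, hp,
        (prod_darts_eq_of_notMem_leaves hG hdeg hpos hpos' hα hv hs hr hp hq).1⟩
  have h2 : ∃ r ∈ c.receivers, ∃ q : G.Walk e.snd r, c.IsDirected q ∧
      ∏ d ∈ q.darts.toFinset, α d = ∏ d ∈ q.darts.toFinset, α' d := by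
    by_cases hv : e.snd ∈ leaves G
    · rw [← c.union_eq, Finset.mem_union] at hv
      exact ⟨_, hv.resolve_left (c.source_no_in e he), .nil, isDirected_nil _, by simp⟩
    · obtain ⟨s, hs, p, hp⟩ := c.exists_isDirected_from_source hG hdeg0 e.snd
      obtain ⟨r, hr, q, hq⟩ := c.exists_isDirected_to_receiver hG hdeg0 e.snd
      exact ⟨r, hr, q, hq,
        (prod_darts_eq_of_notMem_leaves hG hdeg hpos hpos' hα hv hs hr hp hq).2⟩
  obtain ⟨s, hs, p, hp, hpe⟩ := h1
  obtain ⟨r, hr, q, hq, hqe⟩ := h2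
  have he' : c.IsDirected (Walk.cons e.adj .nil) := isDirected_cons.2 ⟨he, isDirected_nil _⟩
  have hpeq := isDirected_append.2 ⟨he', hq⟩
  have h := prod_darts_eq hG hα (isDirected_append.2 ⟨hp, hpeq⟩) hs hr
  rw [prod_darts_append hG α hp hpeq, prod_darts_append hG α' hp hpeq,
    prod_darts_append hG α he' hq, prod_darts_append hG α' he' hq, hpe, hqe] at h
  have h := mul_right_cancel₀ (Finset.prod_pos fun d _ => hpos' d).ne'
    (mul_left_cancel₀ (Finset.prod_pos fun d _ => hpos' d).ne' h)
  simpa using h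

/-! ### Unused links are invisible. -/

/-- The outcome distribution does not depend on the success probabilities of the directed links
outside the configuration. -/
theorem pmf_update (c : Configuration G) (α : G.Dart → ℝ) {e : G.Dart} (he : e ∉ c.links)
    (t : ℝ) : c.pmf (Function.update α e t) = c.pmf α := by
  have hout : ∀ (ω : G.Dart → Bool) b, c.outcome (Function.update ω e b) = c.outcome ω := by
    intro ω b
    have : c.nodeOperation (Function.update ω e b) = c.nodeOperation ω := by
      funext X v
      unfold nodeOperation
      congr 2
      refine Finset.filter_congr fun d hd => ?_
      rw [Function.update_of_ne (fun h : d = e => he (h ▸ hd))]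
    unfold outcome packet
    rw [this]
  -- Flipping the state of `e` keeps the outcome. Adding the flipped sum replaces the factor of `e`
  -- by `β e + (1 - β e) = 1`; each remaining term occurs for both states of `e`, hence the 2.
  have key : ∀ (β : G.Dart → ℝ) (x : c.Outcome), 2 * c.pmf β x = ∑ ω : G.Dart → Bool,
      if c.outcome ω = x then
        ∏ d ∈ Finset.univ.erase e, (if ω d = true then β d else 1 - β d) else 0 := by
    intro β x
    have hflip : c.pmf β x = ∑ ω : G.Dart → Bool, if c.outcome ω = x then
        ∏ d, (if Function.update ω e (!ω e) d = true then β d else 1 - β d) else 0 := by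
      unfold pmf
      refine Finset.sum_nbij' (fun ω => Function.update ω e (!ω e))
        (fun ω => Function.update ω e (!ω e)) ?_ ?_ ?_ ?_ ?_
      · simp
      · simp
      · simp
      · simp
      · intro ω _
        simp [hout]
    rw [two_mul]
    nth_rw 2 [hflip]
    unfold pmf
    rw [← Finset.sum_add_distrib]
    refine Finset.sum_congr rfl fun ω _ => ?_
    split_ifs
    · rw [← Finset.mul_prod_erase _ _ (Finset.mem_univ e),
        ← Finset.mul_prod_erase Finset.univ
          (fun d => if Function.update ω e (!ω e) d = true then β d else 1 - β d)
          (Finset.mem_univ e)]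
      have : ∏ d ∈ Finset.univ.erase e,
          (if Function.update ω e (!ω e) d = true then β d else 1 - β d) =
          ∏ d ∈ Finset.univ.erase e, (if ω d = true then β d else 1 - β d) :=
        Finset.prod_congr rfl fun d hd => by
          rw [Function.update_of_ne (Finset.ne_of_mem_erase hd)]
      rw [this, ← add_mul]
      cases ω e <;> simp
    · simp
  funext x
  have h : 2 * c.pmf (Function.update α e t) x = 2 * c.pmf α x := by
    rw [key, key]
    refine Finset.sum_congr rfl fun ω _ => ?_
    split_ifs
    · refine Finset.prod_congr rfl fun d hd => ?_
      rw [Function.update_of_ne (Finset.ne_of_mem_erase hd)]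
    · rfl
  linarith

end Configuration

/-! ### Identified links are the used links. -/

section Plan

variable {V : Type*} [Fintype V] [DecidableEq V] {G : SimpleGraph V} [DecidableRel G.Adj]

theorem identifies_of_mem_links (hG : G.IsTree) (hdeg : ∀ v, G.degree v = 1 ∨ 3 ≤ G.degree v)
    {k : ℕ} {T : Fin k → Configuration G} {e : G.Dart} {i : Fin k} (he : e ∈ (T i).links) :
    Identifies T e := fun _ _ hα hα' h =>
  Configuration.eq_of_mem_links hG hdeg (fun d => (hα d).1) (fun d => (hα' d).1) (h i) he

/-- A plan identifies only directed links that are used in some round. -/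
theorem exists_mem_links_of_identifies {k : ℕ} {T : Fin k → Configuration G} {e : G.Dart}
    (h : Identifies T e) : ∃ i, e ∈ (T i).links := by
  by_contra! hn
  -- Two admissible vectors that differ only at the unused link `e`.
  have := h (Function.update 1 e 2⁻¹) 1
    (fun d => by rw [Function.update_apply]; split_ifs <;> norm_num)
    (fun d => by simp) (fun i => (T i).pmf_update 1 (hn i) _)
  norm_num at this

end Plan

/-! ### Distances in a tree. -/

section Dist

variable {V : Type*} {G : SimpleGraph V}

theorem length_eq_dist_of_isPath (hG : G.IsTree) {u v : V} {w : G.Walk u v} (hw : w.IsPath) :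
    w.length = G.dist u v := by
  obtain ⟨p, hp⟩ := hG.connected.exists_walk_length_eq_dist u v
  rw [eq_of_isPath hG hw (p.isPath_of_length_eq_dist hp), hp]

theorem exists_adj_dist_lt (hG : G.IsTree) {x v : V} (h : v ≠ x) :
    ∃ w, G.Adj v w ∧ G.dist x w < G.dist x v := by
  obtain ⟨p, hp⟩ := hG.connected.exists_walk_length_eq_dist x v
  obtain ⟨w, q, hw, rfl⟩ := exists_walk_concat p h
  refine ⟨w, hw.symm, ?_⟩
  have := dist_le q
  rw [Walk.length_concat] at hp
  omega

/-- A neighbour closer to `x` is the last node but one on the unique path from `x` to `v`: the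
parent of `v` in the tree rooted at `x`. -/
theorem eq_of_dist_lt (hG : G.IsTree) {x v w w' : V} (hw : G.Adj v w) (hw' : G.Adj v w')
    (h : G.dist x w < G.dist x v) (h' : G.dist x w' < G.dist x v) : w = w' := by
  have key : ∀ w, (hw : G.Adj v w) → G.dist x w < G.dist x v →
      ∃ p : G.Walk x w, (p.concat hw.symm).IsPath := by
    intro w hw h
    obtain ⟨p, hp⟩ := hG.connected.exists_walk_length_eq_dist x w
    refine ⟨p, Walk.isPath_of_length_eq_dist _ (le_antisymm ?_ (dist_le _))⟩
    rw [Walk.length_concat]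
    omega
  obtain ⟨p, hp⟩ := key w hw h
  obtain ⟨p', hp'⟩ := key w' hw' h'
  exact (Walk.concat_inj (eq_of_isPath hG hp hp')).1

/-- Adjacent nodes of a tree are never equidistant from `x`, so every dart points either towards `x`
or away from it. -/
theorem dist_lt_of_not_lt (hG : G.IsTree) {u v : V} (h : G.Adj u v) (x : V)
    (hn : ¬ G.dist x u < G.dist x v) : G.dist x v < G.dist x u :=
  lt_of_le_of_ne (not_lt.1 hn) (hG.dist_ne_of_adj x h).symm

end Dist

theorem mem_leaves {V : Type*} [Fintype V] {G : SimpleGraph V} [DecidableRel G.Adj] {v : V} :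
    v ∈ leaves G ↔ G.degree v = 1 := by
  simp [leaves]

theorem dist_lt_of_mem_leaves {V : Type*} [Fintype V] {G : SimpleGraph V}
    [DecidableRel G.Adj] (hG : G.IsTree) {u v x : V} (hv : v ∈ leaves G) (h : G.Adj v u)
    (hx : v ≠ x) : G.dist x u < G.dist x v := by
  obtain ⟨w, hw, hlt⟩ := exists_adj_dist_lt hG hx
  rw [mem_leaves, degree_eq_one_iff_existsUnique_adj] at hv
  rwa [hv.unique h hw]

variable {V : Type*} [Fintype V] [DecidableEq V] {G : SimpleGraph V} [DecidableRel G.Adj]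

/-! ### Routing a partition of the leaves. -/

/-- Every partition of the leaves into sources and receivers, at least one of each, can be routed:
in the tree rooted at a source, probes flow downwards exactly into the subtrees that contain a
receiver. -/
theorem exists_configuration (hG : G.IsTree) (hdeg : ∀ v, G.degree v = 1 ∨ 3 ≤ G.degree v)
    {S R : Finset V} (hS : S.Nonempty) (hR : R.Nonempty) (hSR : Disjoint S R)
    (hun : S ∪ R = leaves G) : ∃ c : Configuration G, c.sources = S ∧ c.receivers = R := by
  classical
  obtain ⟨s₀, hs₀⟩ := hS
  have hSl : ∀ s ∈ S, s ∈ leaves G := fun s hs => hun ▸ Finset.mem_union_left _ hs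
  have hRl : ∀ r ∈ R, r ∈ leaves G := fun r hr => hun ▸ Finset.mem_union_right _ hr
  have hne : ∀ s ∈ S, ∀ r ∈ R, s ≠ r := fun s hs r hr => Finset.disjoint_iff_ne.1 hSR s hs r hr
  -- `D` says that a dart points down in the tree rooted at `s₀`, `H` that some receiver lies on the
  -- side of its head. An edge with no receiver below it is oriented upwards.
  let D : G.Dart → Prop := fun d => G.dist s₀ d.fst < G.dist s₀ d.snd
  let H : G.Dart → Prop := fun d => ∃ r ∈ R, G.dist r d.snd < G.dist r d.fst
  have hD : ∀ d : G.Dart, D d ↔ ¬ D d.symm := fun d =>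
    ⟨fun h => not_lt.2 (le_of_lt h), fun h => dist_lt_of_not_lt hG d.adj.symm s₀ h⟩
  let links : Finset G.Dart := Finset.univ.filter fun d => (D d ∧ H d) ∨ (D d.symm ∧ ¬ H d.symm)
  have hl : ∀ d, d ∈ links ↔ (D d ∧ H d) ∨ (D d.symm ∧ ¬ H d.symm) := fun d => by simp [links]
  have hparent : ∀ v, v ∉ leaves G → ∃ u, ∃ h : G.Adj u v, D ⟨(u, v), h⟩ ∧
      ∀ w (h : G.Adj v w), w ≠ u → D ⟨(v, w), h⟩ := by
    intro v hv
    obtain ⟨u, hu, hlt⟩ := exists_adj_dist_lt hG (x := s₀) (v := v)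
      fun h => hv (h ▸ hSl s₀ hs₀)
    exact ⟨u, hu.symm, hlt, fun w hw hwu => dist_lt_of_not_lt hG hw.symm s₀
      fun h => hwu (eq_of_dist_lt hG hw hu h hlt)⟩
  refine ⟨⟨links, S, R, ?_, hSR, hun, ?_, ?_, ?_, ?_⟩, rfl, rfl⟩
  · intro d
    rw [hl, hl, Dart.symm_symm, hD d]
    by_cases h : D d.symm <;> simp [h]
  · intro d hd hs
    have hlt : ∀ r ∈ R, G.dist r d.fst < G.dist r d.snd := fun r hr =>
      dist_lt_of_mem_leaves hG (hSl _ hs) d.adj.symm (hne _ hs r hr)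
    rcases (hl d).1 hd with ⟨-, r, hr, h⟩ | ⟨-, h⟩
    · exact lt_asymm h (hlt r hr)
    · obtain ⟨r, hr⟩ := hR
      exact h ⟨r, hr, hlt r hr⟩
  · intro d hd hr
    rcases (hl d).1 hd with ⟨h, -⟩ | ⟨-, h⟩
    · exact lt_asymm h (dist_lt_of_mem_leaves hG (hRl _ hr) d.adj (hne _ hs₀ _ hr).symm)
    · refine h ⟨_, hr, ?_⟩
      change G.dist d.fst d.fst < G.dist d.fst d.snd
      rw [SimpleGraph.dist_self]
      exact hG.connected.pos_dist_of_ne d.adj.ne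
  · intro v hv
    obtain ⟨u, hu, hDu, hch⟩ := hparent v hv
    by_cases hH : H ⟨(u, v), hu⟩
    · exact ⟨_, (hl _).2 (.inl ⟨hDu, hH⟩), rfl⟩
    -- No receiver lies below `v`, hence none below a child `w`, so the edge to `w` is oriented into
    -- `v`.
    · have h3 := (hdeg v).resolve_left fun h => hv (mem_leaves.2 h)
      obtain ⟨w, hw, hwu⟩ := Finset.exists_mem_notMem_of_card_lt_card
        (s := {u}) (t := G.neighborFinset v)
        (by rw [card_neighborFinset_eq_degree, Finset.card_singleton]; omega)
      rw [mem_neighborFinset] at hw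
      rw [Finset.mem_singleton] at hwu
      refine ⟨⟨(w, v), hw.symm⟩, (hl _).2 (.inr ⟨hch w hw hwu, ?_⟩), rfl⟩
      rintro ⟨r, hr, h⟩
      exact hwu (eq_of_dist_lt hG hw hu.symm h
        (dist_lt_of_not_lt hG hu.symm r fun h' => hH ⟨r, hr, h'⟩))
  · intro v hv
    obtain ⟨u, hu, hDu, hch⟩ := hparent v hv
    by_cases hH : H ⟨(u, v), hu⟩
    -- The neighbour of `v` towards a receiver below `v` is a child, and its edge is oriented
    -- downwards.
    · obtain ⟨r, hr, h⟩ := hH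
      obtain ⟨w, hw, hlt⟩ := exists_adj_dist_lt hG (x := r) (v := v) fun h => hv (h ▸ hRl r hr)
      have hwu : w ≠ u := by
        rintro rfl
        exact lt_asymm h hlt
      exact ⟨⟨(v, w), hw⟩, (hl _).2 (.inl ⟨hch w hw hwu, r, hr, hlt⟩), rfl⟩
    · exact ⟨⟨(v, u), hu.symm⟩, (hl _).2 (.inr ⟨hDu, hH⟩), rfl⟩

/-- Degree plus 2 at each leaf is at least 3 everywhere; the sum, with one edge fewer than nodes,
bounds twice the number of leaves below by the number of nodes plus 2. -/
theorem two_le_card_leaves (hG : G.IsTree) (hdeg : ∀ v, G.degree v = 1 ∨ 3 ≤ G.degree v) :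
    2 ≤ (leaves G).card := by
  have h1 : Fintype.card V * 3 ≤ ∑ v, (G.degree v + if v ∈ leaves G then 2 else 0) := by
    rw [← smul_eq_mul, ← Finset.card_univ]
    refine Finset.card_nsmul_le_sum _ _ _ fun v _ => ?_
    rcases hdeg v with h | h
    · rw [if_pos (mem_leaves.2 h), h]
    · omega
  rw [Finset.sum_add_distrib, sum_degrees_eq_twice_card_edges, Finset.sum_ite_mem,
    Finset.univ_inter, Finset.sum_const, smul_eq_mul] at h1
  have h2 := hG.card_edgeFinset
  omega

theorem exists_multicastTree (hG : G.IsTree) (hdeg : ∀ v, G.degree v = 1 ∨ 3 ≤ G.degree v)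
    {A : V} (hA : A ∈ leaves G) : ∃ c : Configuration G, c.sources = {A} := by
  have h : ((leaves G).erase A).Nonempty := by
    rw [← Finset.card_pos, Finset.card_erase_of_mem hA]
    have := two_le_card_leaves hG hdeg
    omega
  obtain ⟨c, hc, -⟩ := exists_configuration hG hdeg (Finset.singleton_nonempty A) h
    (by simp) (by rw [← Finset.insert_eq, Finset.insert_erase hA])
  exact ⟨c, hc⟩

/-! ### Multicast trees and the darts they cover. -/

namespace Configuration

/-- A directed walk from a source, prolonged by `e`, is still a path, and paths in a tree realize
the distance. -/
theorem exists_source_dist_lt (hG : G.IsTree) (hdeg : ∀ v, 0 < G.degree v) {c : Configuration G}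
    {e : G.Dart} (he : e ∈ c.links) : ∃ s ∈ c.sources, G.dist s e.fst < G.dist s e.snd := by
  obtain ⟨s, hs, w, hw⟩ := c.exists_isDirected_from_source hG hdeg e.fst
  have hwe : c.IsDirected (w.concat e.adj) := isDirected_concat.2 ⟨hw, he⟩
  refine ⟨s, hs, ?_⟩
  rw [← length_eq_dist_of_isPath hG (hw.isPath hG), ← length_eq_dist_of_isPath hG (hwe.isPath hG),
    Walk.length_concat]
  exact Nat.lt_succ_self _

/-- The probes of a multicast tree flow away from its root. -/
theorem mem_links_of_dist_lt (hG : G.IsTree) (hdeg : ∀ v, 0 < G.degree v) {c : Configuration G}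
    {A : V} (hc : c.sources = {A}) {e : G.Dart} (h : G.dist A e.fst < G.dist A e.snd) :
    e ∈ c.links := by
  refine (c.mem_links_or e).resolve_right fun he => ?_
  obtain ⟨s, hs, hlt⟩ := exists_source_dist_lt hG hdeg he
  rw [hc, Finset.mem_singleton] at hs
  subst hs
  exact lt_asymm h hlt

end Configuration

theorem exists_leaf_dist_lt (hG : G.IsTree) (hdeg : ∀ v, G.degree v = 1 ∨ 3 ≤ G.degree v)
    (e : G.Dart) : ∃ A ∈ leaves G, G.dist A e.fst < G.dist A e.snd := by
  have hdeg0 : ∀ v, 0 < G.degree v := fun v => by have := hdeg v; omega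
  obtain ⟨A, hA⟩ : (leaves G).Nonempty := by
    have := two_le_card_leaves hG hdeg
    rw [← Finset.card_pos]
    omega
  obtain ⟨c, -⟩ := exists_multicastTree hG hdeg hA
  -- Any configuration serves: it or its dual uses `e`, and a source of that one lies behind `e`.
  rcases c.mem_links_or e with he | he
  · obtain ⟨s, hs, h⟩ := Configuration.exists_source_dist_lt hG hdeg0 he
    exact ⟨s, c.union_eq ▸ Finset.mem_union_left _ hs, h⟩
  · obtain ⟨s, hs, h⟩ := Configuration.exists_source_dist_lt hG hdeg0
      (Configuration.mem_dual_links.2 he)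
    exact ⟨s, c.union_eq ▸ Finset.mem_union_right _ hs, h⟩

/-! ### Comparison of plans. -/

theorem planBandwidth_eq (hG : G.IsTree) (hdeg : ∀ v, 0 < G.degree v) {k : ℕ}
    (T : Fin k → Configuration G) : planBandwidth T = k * G.edgeFinset.card := by
  simp [planBandwidth, Configuration.bandwidth_eq hG hdeg]

/-- A configuration and its dual together identify both directions of every edge. -/
theorem measuresBothDirections_pair_dual (hG : G.IsTree)
    (hdeg : ∀ v, G.degree v = 1 ∨ 3 ≤ G.degree v) (c : Configuration G) :
    MeasuresBothDirections ![c, c.dual] := fun e => by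
  rcases c.mem_links_or e with he | he
  · exact identifies_of_mem_links hG hdeg (i := 0) he
  · exact identifies_of_mem_links hG hdeg (i := 1) (Configuration.mem_dual_links.2 he)

theorem not_measuresBothDirections_single (hdeg : ∀ v, 0 < G.degree v) [Nonempty V]
    (c : Configuration G) : ¬ MeasuresBothDirections ![c] := fun h => by
  obtain ⟨v⟩ := ‹Nonempty V›
  obtain ⟨w, hw⟩ := (G.degree_pos_iff_exists_adj v).1 (hdeg v)
  obtain ⟨i, hi⟩ := exists_mem_links_of_identifies (h ⟨(v, w), hw⟩)
  obtain ⟨j, hj⟩ := exists_mem_links_of_identifies (h (Dart.symm ⟨(v, w), hw⟩))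
  rw [Subsingleton.elim j i] at hj
  exact ((Configuration.mem_links_iff _ _).1 hi) hj

/-- In a plan of multicast trees that measures all links in both directions every leaf is a root. -/
theorem exists_sources_eq_singleton (hdeg : ∀ v, 0 < G.degree v) {k : ℕ}
    {T : Fin k → Configuration G} (hT : ∀ i, (T i).IsMulticastTree)
    (h : MeasuresBothDirections T) {A : V} (hA : A ∈ leaves G) : ∃ i, (T i).sources = {A} := by
  -- The dart leaving `A` must be used in some round; there `A` is not a receiver, so it is the only
  -- source.
  obtain ⟨w, hw⟩ := (G.degree_pos_iff_exists_adj A).1 (hdeg A)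
  obtain ⟨i, hi⟩ := exists_mem_links_of_identifies (h ⟨(A, w), hw⟩)
  rw [← (T i).union_eq, Finset.mem_union] at hA
  have hs := hA.resolve_right ((T i).receiver_no_out _ hi)
  obtain ⟨B, hB⟩ := Finset.card_eq_one.1 (hT i)
  rw [hB, Finset.mem_singleton] at hs
  exact ⟨i, hs ▸ hB⟩

end LossTomography

theorem mainTheorem6 {V : Type*} [Fintype V] [DecidableEq V] (G : SimpleGraph V)
    [DecidableRel G.Adj] (hG : G.IsTree) (hdeg : ∀ v, G.degree v = 1 ∨ 3 ≤ G.degree v)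
    (L : ℕ) (hL : (LossTomography.leaves G).card = L) :
    -- every choice of sources and receivers among the leaves, at least one of each, can be routed
    (∀ S R : Finset V, S.Nonempty → R.Nonempty → Disjoint S R →
      S ∪ R = LossTomography.leaves G →
      ∃ c : LossTomography.Configuration G, c.sources = S ∧ c.receivers = R) ∧
    -- network coding: the configuration and its dual, one probe per link and experiment in each
    (∀ c : LossTomography.Configuration G,
      LossTomography.MeasuresBothDirections ![c, c.dual] ∧
      c.bandwidth = G.edgeFinset.card ∧ c.dual.bandwidth = G.edgeFinset.card ∧
      LossTomography.planBandwidth ![c, c.dual] = 2 * G.edgeFinset.card) ∧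
    -- one round is not enough
    (∀ c : LossTomography.Configuration G, ¬ LossTomography.MeasuresBothDirections ![c]) ∧
    -- multicast trees: each leaf has to be a root, at the cost of a factor of L
    (∀ (k : ℕ) (T : Fin k → LossTomography.Configuration G),
      (∀ i, (T i).IsMulticastTree) → LossTomography.MeasuresBothDirections T →
      (∀ A ∈ LossTomography.leaves G, ∃ i, (T i).sources = {A}) ∧ L ≤ k ∧
      ∀ c : LossTomography.Configuration G,
        L * c.bandwidth ≤ LossTomography.planBandwidth T ∧
        L * LossTomography.planBandwidth ![c, c.dual] ≤ 2 * LossTomography.planBandwidth T) ∧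
    -- and L multicast trees suffice, at exactly that cost
    (∃ T : Fin L → LossTomography.Configuration G,
      (∀ i, (T i).IsMulticastTree) ∧ LossTomography.MeasuresBothDirections T ∧
      LossTomography.planBandwidth T = L * G.edgeFinset.card ∧
      ∀ c : LossTomography.Configuration G,
        LossTomography.planBandwidth T = L * c.bandwidth ∧
        2 * LossTomography.planBandwidth T = L * LossTomography.planBandwidth ![c, c.dual]) := by
  have hdeg0 : ∀ v, 0 < G.degree v := fun v => by have := hdeg v; omega
  have hne : Nonempty V := hG.connected.nonempty
  have hbw : ∀ c : LossTomography.Configuration G, c.bandwidth = G.edgeFinset.card := fun c =>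
    c.bandwidth_eq hG hdeg0
  refine ⟨fun S R hS hR hSR hun => LossTomography.exists_configuration hG hdeg hS hR hSR hun,
    fun c => ⟨LossTomography.measuresBothDirections_pair_dual hG hdeg c, hbw c, hbw c.dual,
      LossTomography.planBandwidth_eq hG hdeg0 _⟩,
    fun c => LossTomography.not_measuresBothDirections_single hdeg0 c, ?_, ?_⟩
  · intro k T hT hmeas
    have hroot : ∀ A ∈ LossTomography.leaves G, ∃ i, (T i).sources = {A} := fun A hA =>
      LossTomography.exists_sources_eq_singleton hdeg0 hT hmeas hA
    have hLk : L ≤ k := by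
      -- Sending each leaf to a round rooted at it is injective, because a round has only one root.
      choose f hf using hroot
      rw [← hL, ← Fintype.card_fin k, ← Fintype.card_coe]
      refine Fintype.card_le_of_injective (fun A => f A.1 A.2) fun A B hAB => Subtype.ext ?_
      have h := hf A A.2
      rw [show f A A.2 = f B B.2 from hAB, hf B B.2] at h
      exact (Finset.singleton_injective h).symm
    refine ⟨hroot, hLk, fun c => ?_⟩
    rw [hbw c, LossTomography.planBandwidth_eq hG hdeg0, LossTomography.planBandwidth_eq hG hdeg0]
    refine ⟨Nat.mul_le_mul_right _ hLk, ?_⟩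
    rw [mul_left_comm]
    exact Nat.mul_le_mul_left _ (Nat.mul_le_mul_right _ hLk)
  · choose f hf using fun A : LossTomography.leaves G =>
      LossTomography.exists_multicastTree hG hdeg A.2
    let a := (LossTomography.leaves G).equivFinOfCardEq hL
    refine ⟨fun i => f (a.symm i), fun i => ?_, fun e => ?_,
      LossTomography.planBandwidth_eq hG hdeg0 _, fun c => ?_⟩
    · rw [LossTomography.Configuration.IsMulticastTree, hf, Finset.card_singleton]
    · obtain ⟨A, hA, hlt⟩ := LossTomography.exists_leaf_dist_lt hG hdeg e
      refine LossTomography.identifies_of_mem_links hG hdeg (i := a ⟨A, hA⟩) ?_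
      exact LossTomography.Configuration.mem_links_of_dist_lt hG hdeg0
        (by simpa using hf ⟨A, hA⟩) hlt
    · rw [hbw c, LossTomography.planBandwidth_eq hG hdeg0, LossTomography.planBandwidth_eq hG hdeg0]
      exact ⟨rfl, by rw [mul_left_comm]⟩
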